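/- Let $p$ be an odd prime, let $n$ be a positive integer with $p \nmid n$, and let $a, b \in \mathbb{Z}_p$ be roots of unity with $b^n = a^{-n}$. For $e \ge 1$ let $T_{a,b,e}$ be the set of pairs $(x,y)$ of integers with $1 \le x, y \le p^e(p-1)$, $p \nmid x$, $p \nmid y$, $x \equiv a \pmod p$, $y \equiv b \pmod p$, such that $$x^{x^n} \equiv y \pmod{p^e} \quad\text{and}\quad y^{y^n} \equiv x \pmod{p^e}.$$ Then, for all $e \ge 1$, $$|T_{a,b,e}| = \begin{cases} p^{\lfloor e/2 \rfloor}\,|T_{a,b,1}| & \text{if } b^n \ne -1,\\ p^{\lfloor e/3 \rfloor + \lfloor (e+1)/3 \rfloor}\,|T_{a,b,1}| & \text{if } b^n = -1. \end{cases}$$ -/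

import Mathlib

/-- The set `T_{a,b,e}` for the map `x ↦ x ^ (x ^ n)`: the pairs `(x, y)` of integers with
`1 ≤ x, y ≤ p ^ e * (p - 1)`, both prime to `p`, such that `x ^ (x ^ n) ≡ y` and
`y ^ (y ^ n) ≡ x` modulo `p ^ e`, and `x ≡ a`, `y ≡ b` modulo `p` (the last two congruences
are in the ring of `p`-adic integers). -/
def twoCycles (p : ℕ) [Fact p.Prime] (n : ℕ) (a b : ℤ_[p]) (e : ℕ) : Set (ℕ × ℕ) :=
  {q | (1 ≤ q.1 ∧ q.1 ≤ p ^ e * (p - 1)) ∧ (1 ≤ q.2 ∧ q.2 ≤ p ^ e * (p - 1)) ∧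
    ¬ p ∣ q.1 ∧ ¬ p ∣ q.2 ∧
    q.1 ^ (q.1 ^ n) ≡ q.2 [MOD p ^ e] ∧ q.2 ^ (q.2 ^ n) ≡ q.1 [MOD p ^ e] ∧
    (p : ℤ_[p]) ∣ (q.1 : ℤ_[p]) - a ∧ (p : ℤ_[p]) ∣ (q.2 : ℤ_[p]) - b}

/-- The set is finite, so its `Set.ncard` is its number of elements. -/
theorem twoCycles_finite (p : ℕ) [Fact p.Prime] (n : ℕ) (a b : ℤ_[p]) (e : ℕ) :
    (twoCycles p n a b e).Finite := by
  refine ((Set.finite_Icc 1 (p ^ e * (p - 1))).prod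
    (Set.finite_Icc 1 (p ^ e * (p - 1)))).subset ?_
  rintro q ⟨h1, h2, -⟩
  exact ⟨h1, h2⟩

/-! Write `v` for the `p`-adic valuation. If `y ≡ x ^ x ^ n` modulo `p ^ e`, then returning to `x`
means `x ^ (x ^ n * y ^ n - 1) ≡ 1`, as `x` is a unit. Lifting the exponent, compared with the root
of unity `a`, gives `v (x ^ m - 1) = v (x - a) + v m` once `x ^ m ≡ 1` modulo `p`. Modulo `p ^ e`
the exponent is itself `x ^ (n * (x ^ n + 1)) - 1`, so a second application turns the condition into
`e ≤ 2 * v (x - a) + v (x ^ n + 1)` (`PadicInt.pow_dvd_sub_iff_le_emultiplicity`). The last term is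
`0` if `a ^ n ≠ -1` and `v (x - a)` otherwise, so the condition is `x ≡ a` modulo `p ^ j` with `j =
⌈e/2⌉` or `⌈e/3⌉`. Each solution modulo `p` then has `p ^ (e - j)` lifts: `x` is free above its
class modulo `p ^ j`, `y` modulo `p ^ e` is determined by `x`, and both keep their residues modulo
`p - 1` (`ncard_approxTwoCycles`). -/

/-- **Lifting the exponent** for the `p`-adic integers, `p` odd. -/
theorem PadicInt.emultiplicity_pow_sub_pow {p : ℕ} [hp : Fact p.Prime] (hp2 : p ≠ 2) {x y : ℤ_[p]}
    (hxy : (p : ℤ_[p]) ∣ x - y) (hx : ¬ (p : ℤ_[p]) ∣ x) (m : ℕ) :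
    emultiplicity (p : ℤ_[p]) (x ^ m - y ^ m) =
      emultiplicity (p : ℤ_[p]) (x - y) + emultiplicity (p : ℤ_[p]) (m : ℤ_[p]) := by
  have hpp : Prime (p : ℤ_[p]) := PadicInt.prime_p
  rcases Nat.eq_zero_or_pos m with rfl | hm
  · simp
  obtain ⟨s, m', hm', rfl⟩ := Nat.exists_eq_pow_mul_and_not_dvd hm.ne' p hp.out.ne_one
  have hm'' : ¬ (p : ℤ_[p]) ∣ (m' : ℤ_[p]) := by
    intro h
    have := (PadicInt.pow_p_dvd_int_iff 1 (m' : ℤ)).1 (by simpa using h)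
    exact hm' (by exact_mod_cast (by simpa using this : (p : ℤ) ∣ m'))
  rw [pow_mul, pow_mul, emultiplicity_pow_sub_pow_of_prime hpp
      (hxy.trans (sub_dvd_pow_sub_pow x y _)) (fun h => hx (hpp.dvd_of_dvd_pow h)) hm'',
    emultiplicity_pow_prime_pow_sub_pow_prime_pow hpp (hp.out.odd_of_ne_two hp2) hxy hx]
  push_cast
  rw [emultiplicity_mul hpp, emultiplicity_eq_zero.2 hm'', add_zero,
    emultiplicity_pow_self hpp.ne_zero hpp.not_isUnit]

theorem PadicInt.pow_dvd_natCast_sub_iff {p : ℕ} [Fact p.Prime] (k x y : ℕ) :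
    (p : ℤ_[p]) ^ k ∣ (x : ℤ_[p]) - y ↔ y ≡ x [MOD p ^ k] := by
  rw [Nat.modEq_iff_dvd]
  have := PadicInt.pow_p_dvd_int_iff (p := p) k ((x : ℤ) - y)
  push_cast at this ⊢
  exact this

theorem PadicInt.dvd_natCast_iff {p : ℕ} [Fact p.Prime] (x : ℕ) :
    (p : ℤ_[p]) ∣ (x : ℤ_[p]) ↔ p ∣ x := by
  have := PadicInt.pow_dvd_natCast_sub_iff (p := p) 1 x 0
  rw [pow_one, pow_one, Nat.cast_zero, sub_zero, Nat.ModEq.comm, Nat.modEq_zero_iff_dvd] at this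
  exact this

theorem PadicInt.not_dvd_unit {p : ℕ} [Fact p.Prime] (c : ℤ_[p]ˣ) :
    ¬ (p : ℤ_[p]) ∣ (c : ℤ_[p]) :=
  fun h => PadicInt.prime_p.not_isUnit (isUnit_of_dvd_unit h c.isUnit)

theorem PadicInt.isUnit_natCast {p : ℕ} [hp : Fact p.Prime] {x : ℕ} (hx : ¬ p ∣ x) :
    IsUnit (x : ℤ_[p]) := by
  rw [PadicInt.isUnit_iff, PadicInt.norm_natCast_eq_one_iff]
  exact (hp.out.coprime_iff_not_dvd).2 hx

/-- A `p`-adic root of unity congruent to `1` modulo `p` is `1`, if `p` is odd. -/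
theorem PadicInt.eq_one_of_isOfFinOrder {p : ℕ} [hp : Fact p.Prime] (hp2 : p ≠ 2) {c : ℤ_[p]ˣ}
    (hc : IsOfFinOrder c) (h : (p : ℤ_[p]) ∣ (c : ℤ_[p]) - 1) : c = 1 := by
  obtain ⟨m, hm, hcm⟩ := isOfFinOrder_iff_pow_eq_one.1 hc
  have hlte := PadicInt.emultiplicity_pow_sub_pow hp2 h (PadicInt.not_dvd_unit c) m
  have hcm' : (c : ℤ_[p]) ^ m = 1 := by
    rw [← Units.val_pow_eq_pow_val, hcm, Units.val_one]
  rw [hcm', one_pow, sub_self, emultiplicity_zero] at hlte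
  have hfin : ∀ z : ℤ_[p], z ≠ 0 → emultiplicity (p : ℤ_[p]) z ≠ ⊤ := fun z hz =>
    finiteMultiplicity_iff_emultiplicity_ne_top.1
      (FiniteMultiplicity.of_prime_left PadicInt.prime_p hz)
  by_contra hne
  have h1 := hfin _ (sub_ne_zero.2 fun h' => hne (Units.ext h'))
  have h2 := hfin (m : ℤ_[p]) (by exact_mod_cast hm.ne')
  exact (WithTop.add_ne_top.2 ⟨h1, h2⟩) hlte.symm

theorem PadicInt.dvd_pow_sub_one_sub_one {p : ℕ} [hp : Fact p.Prime] {x : ℤ_[p]}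
    (hx : ¬ (p : ℤ_[p]) ∣ x) : (p : ℤ_[p]) ∣ x ^ (p - 1) - 1 := by
  have key : ∀ z : ℤ_[p], (p : ℤ_[p]) ∣ z ↔ PadicInt.toZMod z = 0 := by
    intro z
    rw [← RingHom.mem_ker, PadicInt.ker_toZMod, PadicInt.maximalIdeal_eq_span_p,
      Ideal.mem_span_singleton]
  rw [key] at hx ⊢
  rw [map_sub, map_pow, map_one, ZMod.pow_card_sub_one_eq_one hx, sub_self]

theorem PadicInt.pow_sub_one_eq_one_of_isOfFinOrder {p : ℕ} [hp : Fact p.Prime] (hp2 : p ≠ 2)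
    {c : ℤ_[p]ˣ} (hc : IsOfFinOrder c) : c ^ (p - 1) = 1 := by
  refine PadicInt.eq_one_of_isOfFinOrder hp2 hc.pow ?_
  rw [Units.val_pow_eq_pow_val]
  exact PadicInt.dvd_pow_sub_one_sub_one (PadicInt.not_dvd_unit c)

/-- Raising to the power `p - 1` does not change the distance to `1` of a `p`-adic integer
congruent to `1`. -/
theorem PadicInt.emultiplicity_pow_pred_sub_pow_pred {p : ℕ} [hp : Fact p.Prime]
    {x y : ℤ_[p]} (hxy : (p : ℤ_[p]) ∣ x - y) (hx : ¬ (p : ℤ_[p]) ∣ x) :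
    emultiplicity (p : ℤ_[p]) (x ^ (p - 1) - y ^ (p - 1)) = emultiplicity (p : ℤ_[p]) (x - y) := by
  refine emultiplicity_pow_sub_pow_of_prime PadicInt.prime_p hxy hx ?_
  rw [PadicInt.dvd_natCast_iff]
  have h2 := hp.out.two_le
  exact Nat.not_dvd_of_pos_of_lt (by omega) (by omega)

/-- The valuation of `x ^ m - 1`, when `x` is congruent to the root of unity `a` and `x ^ m` to
`1`. -/
theorem PadicInt.emultiplicity_pow_sub_one {p : ℕ} [hp : Fact p.Prime] (hp2 : p ≠ 2)
    {x : ℤ_[p]} {a : ℤ_[p]ˣ} (ha : IsOfFinOrder a) (hxa : (p : ℤ_[p]) ∣ x - a)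
    (hx : ¬ (p : ℤ_[p]) ∣ x) {m : ℕ} (hm : (p : ℤ_[p]) ∣ x ^ m - 1) :
    emultiplicity (p : ℤ_[p]) (x ^ m - 1) =
      emultiplicity (p : ℤ_[p]) (x - a) + emultiplicity (p : ℤ_[p]) (m : ℤ_[p]) := by
  have hpp : Prime (p : ℤ_[p]) := PadicInt.prime_p
  have ha1 : (a : ℤ_[p]) ^ (p - 1) = 1 := by
    rw [← Units.val_pow_eq_pow_val, PadicInt.pow_sub_one_eq_one_of_isOfFinOrder hp2 ha,
      Units.val_one]
  -- Raising to the power `p - 1` sends `a` to `1`, so lifting the exponent applies to `x ^ (p - 1)`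
  -- and `1`.
  rw [← PadicInt.emultiplicity_pow_pred_sub_pow_pred hm (fun h => hx (hpp.dvd_of_dvd_pow h)),
    ← PadicInt.emultiplicity_pow_pred_sub_pow_pred hxa hx, ha1, one_pow, ← pow_mul, mul_comm m,
    pow_mul]
  have := PadicInt.emultiplicity_pow_sub_pow hp2 (y := 1)
    (PadicInt.dvd_pow_sub_one_sub_one hx) (fun h => hx (hpp.dvd_of_dvd_pow h)) m
  rwa [one_pow] at this

/-- Only divisibility by `q ^ (e - k)` is at stake, and congruence modulo `q ^ e` preserves it. -/
theorem le_add_emultiplicity_iff_of_dvd_sub {R : Type*} [CommRing R] {q u v : R} {e : ℕ}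
    (h : q ^ e ∣ u - v) (k : ℕ∞) :
    (e : ℕ∞) ≤ k + emultiplicity q u ↔ (e : ℕ∞) ≤ k + emultiplicity q v := by
  induction k using ENat.recTopCoe with
  | top => simp
  | coe k =>
    have key : ∀ A : ℕ∞, (e : ℕ∞) ≤ k + A ↔ ((e - k : ℕ) : ℕ∞) ≤ A := by
      intro A
      induction A using ENat.recTopCoe with
      | top => simp
      | coe A => norm_cast; omega
    rw [key, key, ← pow_dvd_iff_le_emultiplicity, ← pow_dvd_iff_le_emultiplicity]
    exact dvd_iff_dvd_of_dvd_sub ((pow_dvd_pow q (Nat.sub_le e k)).trans h)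

/-! ### The closing condition as a valuation inequality -/

/-- If `y` is the image of `x`, then the image of `y` is `x` modulo `p ^ e` if and only if `x`
is close to the root of unity `a`. -/
theorem PadicInt.pow_dvd_sub_iff_le_emultiplicity {p : ℕ} [hp : Fact p.Prime] (hp2 : p ≠ 2) {n : ℕ}
    (hn : ¬ p ∣ n) {a b : ℤ_[p]ˣ} (ha : IsOfFinOrder a)
    (hab : b ^ n * a ^ n = 1) {e : ℕ} (he : 1 ≤ e) {x y : ℕ} (hx : ¬ p ∣ x) (hy : ¬ p ∣ y)
    (hxa : (p : ℤ_[p]) ∣ (x : ℤ_[p]) - a) (hyb : (p : ℤ_[p]) ∣ (y : ℤ_[p]) - b)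
    (hxy : (p : ℤ_[p]) ^ e ∣ (y : ℤ_[p]) - (x : ℤ_[p]) ^ x ^ n)
    (hyx : (p : ℤ_[p]) ∣ (y : ℤ_[p]) ^ y ^ n - x) :
    (p : ℤ_[p]) ^ e ∣ (y : ℤ_[p]) ^ y ^ n - x ↔
      (e : ℕ∞) ≤ emultiplicity (p : ℤ_[p]) ((x : ℤ_[p]) - a) +
        (emultiplicity (p : ℤ_[p]) ((x : ℤ_[p]) - a) +
          emultiplicity (p : ℤ_[p]) ((x : ℤ_[p]) ^ n + 1)) := by
  have hpp : Prime (p : ℤ_[p]) := PadicInt.prime_p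
  have hX : ¬ (p : ℤ_[p]) ∣ (x : ℤ_[p]) := by rwa [PadicInt.dvd_natCast_iff]
  have hx0 : x ≠ 0 := by rintro rfl; simp at hx
  have hy0 : y ≠ 0 := by rintro rfl; simp at hy
  obtain ⟨N, hN⟩ : ∃ N, x ^ n * y ^ n = N + 1 := Nat.exists_eq_succ_of_ne_zero (by positivity)
  have hNc : (N : ℤ_[p]) = (x : ℤ_[p]) ^ n * (y : ℤ_[p]) ^ n - 1 := by
    have : ((x ^ n * y ^ n : ℕ) : ℤ_[p]) = ((N + 1 : ℕ) : ℤ_[p]) := by rw [hN]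
    push_cast at this
    rw [this]; ring
  have hpe : (p : ℤ_[p]) ∣ (p : ℤ_[p]) ^ e := dvd_pow_self _ (by omega)
  -- Needed for `q = p ^ e`, the claim itself, and for `q = p`, the hypothesis of the valuation
  -- formula.
  have hstep : ∀ q : ℤ_[p], q ∣ (p : ℤ_[p]) ^ e →
      (q ∣ (y : ℤ_[p]) ^ y ^ n - x ↔ q ∣ (x : ℤ_[p]) ^ N - 1) := by
    intro q hq
    have h1 : q ∣ ((y : ℤ_[p]) ^ y ^ n - x) - ((x : ℤ_[p]) * ((x : ℤ_[p]) ^ N - 1)) := by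
      have : ((y : ℤ_[p]) ^ y ^ n - x) - ((x : ℤ_[p]) * ((x : ℤ_[p]) ^ N - 1)) =
          (y : ℤ_[p]) ^ y ^ n - ((x : ℤ_[p]) ^ x ^ n) ^ y ^ n := by
        rw [← pow_mul, hN]; ring
      rw [this]
      exact (hq.trans hxy).trans (sub_dvd_pow_sub_pow _ _ _)
    rw [dvd_iff_dvd_of_dvd_sub h1, (PadicInt.isUnit_natCast hx).dvd_mul_left]
  rw [hstep _ dvd_rfl, pow_dvd_iff_le_emultiplicity,
    PadicInt.emultiplicity_pow_sub_one hp2 ha hxa hX ((hstep _ hpe).1 hyx), hNc]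
  have habc : (b : ℤ_[p]) ^ n * (a : ℤ_[p]) ^ n = 1 := by
    simpa using congrArg Units.val hab
  have hN1 : (p : ℤ_[p]) ∣ (x : ℤ_[p]) ^ n * (y : ℤ_[p]) ^ n - 1 := by
    have : (x : ℤ_[p]) ^ n * (y : ℤ_[p]) ^ n - 1 = ((x : ℤ_[p]) ^ n - (a : ℤ_[p]) ^ n) *
        (y : ℤ_[p]) ^ n + (a : ℤ_[p]) ^ n * ((y : ℤ_[p]) ^ n - (b : ℤ_[p]) ^ n) := by
      linear_combination habc
    rw [this]
    exact dvd_add ((hxa.trans (sub_dvd_pow_sub_pow _ _ _)).mul_right _)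
      ((hyb.trans (sub_dvd_pow_sub_pow _ _ _)).mul_left _)
  -- Replacing `y` by `x ^ x ^ n` makes the exponent `N` again of the form `x ^ m - 1`.
  have hdiff : (p : ℤ_[p]) ^ e ∣ ((x : ℤ_[p]) ^ n * (y : ℤ_[p]) ^ n - 1) -
      ((x : ℤ_[p]) ^ (n * (x ^ n + 1)) - 1) := by
    have : ((x : ℤ_[p]) ^ n * (y : ℤ_[p]) ^ n - 1) - ((x : ℤ_[p]) ^ (n * (x ^ n + 1)) - 1) =
        (x : ℤ_[p]) ^ n * ((y : ℤ_[p]) ^ n - ((x : ℤ_[p]) ^ x ^ n) ^ n) := by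
      ring
    rw [this]
    exact (hxy.trans (sub_dvd_pow_sub_pow _ _ _)).mul_left _
  rw [le_add_emultiplicity_iff_of_dvd_sub hdiff,
    PadicInt.emultiplicity_pow_sub_one hp2 ha hxa hX
      ((dvd_iff_dvd_of_dvd_sub (hpe.trans hdiff)).1 hN1)]
  push_cast
  rw [emultiplicity_mul hpp (a := (n : ℤ_[p])),
    emultiplicity_eq_zero.2 (mt (PadicInt.dvd_natCast_iff n).1 hn), zero_add]

/-- Otherwise the root of unity `-(a ^ n)` would be congruent to `1`, hence equal to it. -/
theorem PadicInt.emultiplicity_pow_add_one_of_ne {p : ℕ} [hp : Fact p.Prime] (hp2 : p ≠ 2)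
    {n : ℕ} {a : ℤ_[p]ˣ} (ha : IsOfFinOrder a) (han : a ^ n ≠ -1) {x : ℤ_[p]}
    (hxa : (p : ℤ_[p]) ∣ x - a) : emultiplicity (p : ℤ_[p]) (x ^ n + 1) = 0 := by
  refine emultiplicity_eq_zero.2 fun h => han ?_
  have hfin : IsOfFinOrder (-(a ^ n)) := by
    obtain ⟨m, hm, ham⟩ := isOfFinOrder_iff_pow_eq_one.1 (ha.pow (n := n))
    exact isOfFinOrder_iff_pow_eq_one.2 ⟨2 * m, by omega, by rw [pow_mul, neg_sq, ← pow_mul,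
      mul_comm, pow_mul, ham, one_pow]⟩
  have := PadicInt.eq_one_of_isOfFinOrder hp2 hfin (by
    push_cast
    have : -(a : ℤ_[p]) ^ n - 1 = (x ^ n - (a : ℤ_[p]) ^ n) - (x ^ n + 1) := by ring
    rw [this]
    exact dvd_sub (hxa.trans (sub_dvd_pow_sub_pow _ _ _)) h)
  rw [← this, neg_neg]

theorem PadicInt.emultiplicity_pow_add_one_of_eq {p : ℕ} [hp : Fact p.Prime]
    {n : ℕ} (hn : ¬ p ∣ n) {a : ℤ_[p]ˣ} (han : a ^ n = -1) {x : ℤ_[p]}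
    (hxa : (p : ℤ_[p]) ∣ x - a) (hx : ¬ (p : ℤ_[p]) ∣ x) :
    emultiplicity (p : ℤ_[p]) (x ^ n + 1) = emultiplicity (p : ℤ_[p]) (x - a) := by
  have h : (a : ℤ_[p]) ^ n = -1 := by simpa using congrArg Units.val han
  rw [← emultiplicity_pow_sub_pow_of_prime PadicInt.prime_p hxa hx
    (by rwa [PadicInt.dvd_natCast_iff]), h, sub_neg_eq_add]

/-! ### Counting lifts by the Chinese remainder theorem -/

theorem Nat.exists_modEq_modEq_pred {p : ℕ} (hp : p.Prime) (e r s : ℕ) :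
    ∃ z, (1 ≤ z ∧ z ≤ p ^ e * (p - 1)) ∧ z ≡ r [MOD p ^ e] ∧ z ≡ s [MOD p - 1] := by
  have hpos : 0 < p ^ e * (p - 1) :=
    Nat.mul_pos (pow_pos hp.pos e) (Nat.sub_pos_of_lt hp.one_lt)
  have hco : Nat.Coprime (p ^ e) (p - 1) :=
    Nat.Coprime.pow_left e ((Nat.coprime_self_sub_right hp.one_lt.le).2 (Nat.coprime_one_right p))
  obtain ⟨k, hk1, hk2⟩ := Nat.chineseRemainder hco r s
  obtain ⟨z, hz, hzk⟩ : ∃ z, (1 ≤ z ∧ z ≤ p ^ e * (p - 1)) ∧ z ≡ k [MOD p ^ e * (p - 1)] := by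
    rcases Nat.eq_zero_or_pos (k % (p ^ e * (p - 1))) with h | h
    -- The range starts at `1`, so the zero class is represented by the modulus.
    · exact ⟨_, ⟨hpos, le_rfl⟩, by rw [Nat.ModEq, h, Nat.mod_self]⟩
    · exact ⟨_, ⟨h, (Nat.mod_lt _ hpos).le⟩, Nat.mod_modEq _ _⟩
  exact ⟨z, hz, (hzk.of_mul_right _).trans hk1, (hzk.of_mul_left _).trans hk2⟩

theorem Nat.eq_of_modEq_modEq_pred {p : ℕ} (hp : p.Prime) {e z w : ℕ}
    (hz : 1 ≤ z ∧ z ≤ p ^ e * (p - 1)) (hw : 1 ≤ w ∧ w ≤ p ^ e * (p - 1))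
    (h1 : z ≡ w [MOD p ^ e]) (h2 : z ≡ w [MOD p - 1]) : z = w := by
  have hco : Nat.Coprime (p ^ e) (p - 1) :=
    Nat.Coprime.pow_left e ((Nat.coprime_self_sub_right hp.one_lt.le).2 (Nat.coprime_one_right p))
  have h := (Nat.modEq_and_modEq_iff_modEq_mul hco).1 ⟨h1, h2⟩
  have h' : z - 1 ≡ w - 1 [MOD p ^ e * (p - 1)] := by
    refine Nat.ModEq.add_right_cancel' 1 ?_
    rwa [Nat.sub_add_cancel hz.1, Nat.sub_add_cancel hw.1]
  have := h'.eq_of_lt_of_lt (by omega) (by omega)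
  omega

theorem Nat.ModEq.pow_modEq_pow_of_prime {p : ℕ} (hp : p.Prime) {x x' m m' : ℕ} (hx : ¬ p ∣ x)
    (h : x ≡ x' [MOD p]) (hm : m ≡ m' [MOD p - 1]) : x ^ m ≡ x' ^ m' [MOD p] := by
  refine Nat.ModEq.trans ?_ (h.pow m')
  have hf : x ^ (p - 1) ≡ 1 [MOD p] := by
    rw [← Nat.totient_prime hp]
    exact Nat.ModEq.pow_totient ((hp.coprime_iff_not_dvd.2 hx).symm)
  have key : ∀ k, x ^ k ≡ x ^ (k % (p - 1)) [MOD p] := by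
    intro k
    conv_lhs => rw [← Nat.mod_add_div k (p - 1), pow_add, pow_mul]
    simpa using (hf.pow (k / (p - 1))).mul_left (x ^ (k % (p - 1)))
  have hmm : m % (p - 1) = m' % (p - 1) := hm
  exact (key m).trans (hmm ▸ (key m').symm)

theorem Nat.ModEq.pow_pow_modEq {p : ℕ} (hp : p.Prime) {x x' : ℕ} (n : ℕ) (hx : ¬ p ∣ x)
    (h : x ≡ x' [MOD p]) (h' : x ≡ x' [MOD p - 1]) : x ^ x ^ n ≡ x' ^ x' ^ n [MOD p] :=
  Nat.ModEq.pow_modEq_pow_of_prime hp hx h (h'.pow n)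

/-- The pairs in which `y` is the image of `x` modulo `p ^ e`, `x` is the image of `y` modulo
`p`, and `x`, `y` lie in fixed classes modulo `p ^ j` and `p`. -/
def approxTwoCycles (p n α β e j : ℕ) : Set (ℕ × ℕ) :=
  {q | (1 ≤ q.1 ∧ q.1 ≤ p ^ e * (p - 1)) ∧ (1 ≤ q.2 ∧ q.2 ≤ p ^ e * (p - 1)) ∧
    ¬ p ∣ q.1 ∧ ¬ p ∣ q.2 ∧
    q.1 ^ (q.1 ^ n) ≡ q.2 [MOD p ^ e] ∧ q.2 ^ (q.2 ^ n) ≡ q.1 [MOD p] ∧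
    q.1 ≡ α [MOD p ^ j] ∧ q.2 ≡ β [MOD p]}

/-- A pair at level `1` and a digit block `t < p ^ (e - j)` determine a pair at level `e`: `x` is `α
+ p ^ j * t` modulo `p ^ e`, `y` is the image of `x`, and residues modulo `p - 1` are kept. By
Fermat these residues control the exponents modulo `p`. -/
theorem ncard_approxTwoCycles {p : ℕ} (hp : p.Prime) (n α β : ℕ) {e j : ℕ} (hj : 1 ≤ j)
    (hje : j ≤ e) :
    (approxTwoCycles p n α β e j).ncard =
      p ^ (e - j) * (approxTwoCycles p n α β 1 1).ncard := by
  choose rep hrep hrep1 hrep2 using Nat.exists_modEq_modEq_pred hp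
  have he : 1 ≤ e := hj.trans hje
  have hpj : p ∣ p ^ j := dvd_pow_self _ (by omega)
  have hpe : p ∣ p ^ e := dvd_pow_self _ (by omega)
  have hsplit : p ^ j * p ^ (e - j) = p ^ e := by rw [← pow_add]; congr 1; omega
  have hndvd : ∀ {u v : ℕ}, u ≡ v [MOD p] → ¬ p ∣ v → ¬ p ∣ u := fun h hv hu =>
    hv ((h.dvd_iff dvd_rfl).1 hu)
  set F : ℕ → ℕ → ℕ := fun x1 t => rep e (α + p ^ j * t) x1 with hF
  set G : ℕ → ℕ → ℕ := fun x y1 => rep e (x ^ x ^ n) y1 with hG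
  set f : (ℕ × ℕ) × ℕ → ℕ × ℕ := fun q => (F q.1.1 q.2, G (F q.1.1 q.2) q.1.2) with hf
  have hFj : ∀ x1 t, F x1 t ≡ α [MOD p ^ j] := by
    intro x1 t
    refine ((hrep1 e (α + p ^ j * t) x1).of_dvd (pow_dvd_pow p hje)).trans ?_
    simp [Nat.ModEq]
  have hFp : ∀ x1 t, F x1 t ≡ α [MOD p] := fun x1 t => (hFj x1 t).of_dvd hpj
  have hbij : Set.BijOn f (approxTwoCycles p n α β 1 1 ×ˢ Set.Iio (p ^ (e - j)))
      (approxTwoCycles p n α β e j) := by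
    refine ⟨?_, ?_, ?_⟩
    · rintro ⟨⟨x1, y1⟩, t⟩ ⟨⟨hx1, hy1, hpx, hpy, hxy, hyx, hxα, hyβ⟩, ht⟩
      simp only [pow_one] at hx1 hy1 hpx hpy hxy hyx hxα hyβ
      have hx : F x1 t ≡ x1 [MOD p] := (hFp x1 t).trans hxα.symm
      have hpx' := hndvd hx hpx
      have hy : G (F x1 t) y1 ≡ y1 [MOD p] :=
        ((hrep1 e _ y1).of_dvd hpe).trans
          ((Nat.ModEq.pow_pow_modEq hp n hpx' hx (hrep2 e _ x1)).trans hxy)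
      have hpy' := hndvd hy hpy
      exact ⟨hrep _ _ _, hrep _ _ _, hpx', hpy', (hrep1 e _ y1).symm,
        (Nat.ModEq.pow_pow_modEq hp n hpy' hy (hrep2 e _ y1)).trans (hyx.trans hx.symm),
        hFj x1 t, hy.trans hyβ⟩
    · rintro ⟨⟨x1, y1⟩, t⟩ ⟨⟨hx1, hy1, hpx, hpy, hxy, hyx, hxα, hyβ⟩, ht⟩
        ⟨⟨x2, y2⟩, s⟩ ⟨⟨hx2, hy2, hpx2, hpy2, hxy2, hyx2, hxα2, hyβ2⟩, hs⟩ h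
      simp only at hx1 hy1 hxα hyβ hx2 hy2 hxα2 hyβ2
      simp only [hf, Prod.mk.injEq] at h
      obtain ⟨h1, h2⟩ := h
      have ex : x1 = x2 := by
        refine Nat.eq_of_modEq_modEq_pred hp hx1 hx2 (hxα.trans hxα2.symm) ?_
        exact (hrep2 e _ x1).symm.trans (Eq.trans (congrArg (· % (p - 1)) h1) (hrep2 e _ x2))
      have ey : y1 = y2 := by
        refine Nat.eq_of_modEq_modEq_pred hp hy1 hy2
          (by simpa using hyβ.trans hyβ2.symm) ?_
        exact (hrep2 e _ y1).symm.trans (Eq.trans (congrArg (· % (p - 1)) h2) (hrep2 e _ y2))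
      have et : α + p ^ j * t ≡ α + p ^ j * s [MOD p ^ e] :=
        (hrep1 e _ x1).symm.trans (Eq.trans (congrArg (· % (p ^ e)) h1) (hrep1 e _ x2))
      have et' := Nat.ModEq.add_left_cancel' _ et
      rw [← hsplit] at et'
      have := (Nat.ModEq.mul_left_cancel' (pow_pos hp.pos j).ne' et').eq_of_lt_of_lt ht hs
      rw [ex, ey, this]
    · rintro ⟨x, y⟩ ⟨hx, hy, hpx, hpy, hxy, hyx, hxα, hyβ⟩
      simp only at hx hy hpx hpy hxy hyx hxα hyβ
      have hx1 : rep 1 x x ≡ x [MOD p] := by simpa using hrep1 1 x x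
      have hy1 : rep 1 y y ≡ y [MOD p] := by simpa using hrep1 1 y y
      have hx2 := hrep2 1 x x
      have hy2 := hrep2 1 y y
      have hpx1 := hndvd hx1 hpx
      have hpy1 := hndvd hy1 hpy
      -- Adding `p ^ e * α` keeps the subtraction of `α` within the naturals without changing `x`
      -- modulo `p ^ e`.
      obtain ⟨w, hw⟩ : ∃ w, x + p ^ e * α = α + p ^ j * w := by
        have hle : α ≤ x + p ^ e * α :=
          (Nat.le_mul_of_pos_left α (pow_pos hp.pos e)).trans (Nat.le_add_left _ _)
        have hmod : α ≡ x + p ^ e * α [MOD p ^ j] := by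
          refine hxα.symm.trans ?_
          rw [← hsplit, mul_assoc]
          simp [Nat.ModEq]
        obtain ⟨w, hw⟩ := (Nat.modEq_iff_dvd' hle).1 hmod
        exact ⟨w, by omega⟩
      have hxt : α + p ^ j * (w % p ^ (e - j)) ≡ x [MOD p ^ e] := by
        have h1 : p ^ j * (w % p ^ (e - j)) ≡ p ^ j * w [MOD p ^ e] := by
          rw [← hsplit]
          exact (Nat.mod_modEq _ _).mul_left' _
        refine (h1.add_left α).trans ?_
        rw [← hw]
        simp [Nat.ModEq]
      have eF : F (rep 1 x x) (w % p ^ (e - j)) = x :=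
        Nat.eq_of_modEq_modEq_pred hp (hrep _ _ _) hx ((hrep1 e _ _).trans hxt)
          ((hrep2 e _ _).trans hx2)
      refine ⟨((rep 1 x x, rep 1 y y), w % p ^ (e - j)), ⟨⟨hrep _ _ _, hrep _ _ _, hpx1, hpy1,
        ?_, ?_, ?_, hy1.trans hyβ⟩, Nat.mod_lt _ (pow_pos hp.pos _)⟩, ?_⟩
      · rw [pow_one]
        exact (Nat.ModEq.pow_pow_modEq hp n hpx1 hx1 hx2).trans
          ((hxy.of_dvd hpe).trans hy1.symm)
      · exact (Nat.ModEq.pow_pow_modEq hp n hpy1 hy1 hy2).trans (hyx.trans hx1.symm)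
      · rw [pow_one]
        exact hx1.trans (hxα.of_dvd hpj)
      · simp only [hf, eF, Prod.mk.injEq, true_and]
        exact Nat.eq_of_modEq_modEq_pred hp (hrep _ _ _) hy ((hrep1 e _ _).trans hxy)
          ((hrep2 e _ _).trans hy2)
  rw [← hbij.image_eq, hbij.injOn.ncard_image, Set.ncard_prod, Set.ncard_Iio_nat,
    mul_comm]

/-! ### From `p`-adic conditions to congruences -/

theorem PadicInt.pow_dvd_natCast_sub_iff_modEq_appr {p : ℕ} [Fact p.Prime] (a : ℤ_[p]) {k e : ℕ}
    (hk : k ≤ e) (x : ℕ) :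
    (p : ℤ_[p]) ^ k ∣ (x : ℤ_[p]) - a ↔ x ≡ a.appr e [MOD p ^ k] := by
  rw [Nat.ModEq.comm, ← PadicInt.pow_dvd_natCast_sub_iff]
  refine dvd_iff_dvd_of_dvd_sub ?_
  have : (x : ℤ_[p]) - a - (x - a.appr e) = -(a - a.appr e) := by ring
  rw [this, dvd_neg]
  exact (pow_dvd_pow _ hk).trans (Ideal.mem_span_singleton.1 (PadicInt.appr_spec e a))

theorem twoCycles_eq_approxTwoCycles {p : ℕ} [hp : Fact p.Prime] (hp2 : p ≠ 2) {n : ℕ}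
    (hn : ¬ p ∣ n) {a b : ℤ_[p]ˣ} (ha : IsOfFinOrder a) (hab : b ^ n * a ^ n = 1) {e j d : ℕ}
    (hj : 1 ≤ j) (hje : j ≤ e) (hed : e ≤ d)
    (h : ∀ x : ℤ_[p], (p : ℤ_[p]) ∣ x - a → ¬ (p : ℤ_[p]) ∣ x →
      ((e : ℕ∞) ≤ emultiplicity (p : ℤ_[p]) (x - a) + (emultiplicity (p : ℤ_[p]) (x - a) +
        emultiplicity (p : ℤ_[p]) (x ^ n + 1)) ↔
        (j : ℕ∞) ≤ emultiplicity (p : ℤ_[p]) (x - a))) :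
    twoCycles p n a b e =
      approxTwoCycles p n ((a : ℤ_[p]).appr d) ((b : ℤ_[p]).appr d) e j := by
  ext ⟨x, y⟩
  have he : 1 ≤ e := hj.trans hje
  have hpe : p ∣ p ^ e := dvd_pow_self _ (by omega)
  have hpj : p ∣ p ^ j := dvd_pow_self _ (by omega)
  have hone : ∀ (c : ℤ_[p]) (z : ℕ), (p : ℤ_[p]) ∣ (z : ℤ_[p]) - c ↔ z ≡ c.appr d [MOD p] := by
    intro c z
    simpa using PadicInt.pow_dvd_natCast_sub_iff_modEq_appr c (he.trans hed) z
  have hcrit : ¬ p ∣ x → ¬ p ∣ y → x ^ x ^ n ≡ y [MOD p ^ e] → y ^ y ^ n ≡ x [MOD p] →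
      x ≡ (a : ℤ_[p]).appr d [MOD p] → y ≡ (b : ℤ_[p]).appr d [MOD p] →
      (y ^ y ^ n ≡ x [MOD p ^ e] ↔ x ≡ (a : ℤ_[p]).appr d [MOD p ^ j]) := by
    intro hx hy hxy hyx hxa hyb
    have hxa' := (hone _ _).2 hxa
    have hX : ¬ (p : ℤ_[p]) ∣ (x : ℤ_[p]) := by rwa [PadicInt.dvd_natCast_iff]
    rw [← PadicInt.pow_dvd_natCast_sub_iff_modEq_appr _ (hje.trans hed),
      pow_dvd_iff_le_emultiplicity, ← h _ hxa' hX, Nat.ModEq.comm,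
      ← PadicInt.pow_dvd_natCast_sub_iff, Nat.cast_pow]
    refine PadicInt.pow_dvd_sub_iff_le_emultiplicity hp2 hn ha hab he hx hy hxa'
      ((hone _ _).2 hyb) ?_ ?_
    · exact_mod_cast (PadicInt.pow_dvd_natCast_sub_iff e y (x ^ x ^ n)).2 hxy
    · have := (PadicInt.pow_dvd_natCast_sub_iff (p := p) 1 (y ^ y ^ n) x).2
        (by simpa using hyx.symm)
      simpa using this
  constructor
  · rintro ⟨h1, h2, h3, h4, h5, h6, h7, h8⟩
    simp only [hone] at h7 h8
    exact ⟨h1, h2, h3, h4, h5, h6.of_dvd hpe, (hcrit h3 h4 h5 (h6.of_dvd hpe) h7 h8).1 h6, h8⟩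
  · rintro ⟨h1, h2, h3, h4, h5, h6, h7, h8⟩
    have h7' := h7.of_dvd hpj
    exact ⟨h1, h2, h3, h4, h5, (hcrit h3 h4 h5 h6 h7' h8).2 h7, (hone _ _).2 h7', (hone _ _).2 h8⟩

theorem theorem4p4 (p : ℕ) [Fact p.Prime] (hp : p ≠ 2) (n : ℕ) (hn : ¬ p ∣ n)
    (a b : ℤ_[p]ˣ) (ha : IsOfFinOrder a) (hb : IsOfFinOrder b) (hab : b ^ n = a ^ (-(n : ℤ))) :
    ∀ e : ℕ, 1 ≤ e →
      (b ^ n ≠ -1 →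
        (twoCycles p n a b e).ncard = p ^ (e / 2) * (twoCycles p n a b 1).ncard) ∧
      (b ^ n = -1 →
        (twoCycles p n a b e).ncard =
          p ^ (e / 3 + (e + 1) / 3) * (twoCycles p n a b 1).ncard) := by
  have hab' : b ^ n * a ^ n = 1 := by
    rw [hab, zpow_neg, zpow_natCast, inv_mul_cancel]
  have hpow : a ^ n = -1 ↔ b ^ n = -1 := by
    rw [eq_inv_of_mul_eq_one_left hab', inv_eq_iff_eq_inv, inv_neg_one]
  intro e he
  refine ⟨fun hne => ?_, fun heq => ?_⟩
  -- `(i + 1) / 2` is `⌈i/2⌉`, which is `1` at `i = 1`.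
  · have key : ∀ i : ℕ, ∀ x : ℤ_[p], (p : ℤ_[p]) ∣ x - a → ¬ (p : ℤ_[p]) ∣ x →
        ((i : ℕ∞) ≤ emultiplicity (p : ℤ_[p]) (x - a) + (emultiplicity (p : ℤ_[p]) (x - a) +
          emultiplicity (p : ℤ_[p]) (x ^ n + 1)) ↔
          (((i + 1) / 2 : ℕ) : ℕ∞) ≤ emultiplicity (p : ℤ_[p]) (x - a)) := by
      intro i x hx _
      rw [PadicInt.emultiplicity_pow_add_one_of_ne hp ha (mt hpow.1 hne) hx, add_zero]
      generalize emultiplicity (p : ℤ_[p]) (x - a) = k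
      induction k using ENat.recTopCoe with
      | top => simp
      | coe k => norm_cast; omega
    rw [twoCycles_eq_approxTwoCycles hp hn ha hab' (by omega) (by omega) le_rfl (key e),
      -- Taking `d = e` at level `1` too gives both sets the same `α` and `β`.
      twoCycles_eq_approxTwoCycles hp hn ha hab' (d := e) le_rfl le_rfl he (key 1),
      ncard_approxTwoCycles Fact.out n _ _ (by omega) (by omega)]
    congr 2
    omega
  · have key : ∀ i : ℕ, ∀ x : ℤ_[p], (p : ℤ_[p]) ∣ x - a → ¬ (p : ℤ_[p]) ∣ x →
        ((i : ℕ∞) ≤ emultiplicity (p : ℤ_[p]) (x - a) + (emultiplicity (p : ℤ_[p]) (x - a) +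
          emultiplicity (p : ℤ_[p]) (x ^ n + 1)) ↔
          (((i + 2) / 3 : ℕ) : ℕ∞) ≤ emultiplicity (p : ℤ_[p]) (x - a)) := by
      intro i x hx hx'
      rw [PadicInt.emultiplicity_pow_add_one_of_eq hn (hpow.2 heq) hx hx']
      generalize emultiplicity (p : ℤ_[p]) (x - a) = k
      induction k using ENat.recTopCoe with
      | top => simp
      | coe k => norm_cast; omega
    rw [twoCycles_eq_approxTwoCycles hp hn ha hab' (by omega) (by omega) le_rfl (key e),
      twoCycles_eq_approxTwoCycles hp hn ha hab' (d := e) le_rfl le_rfl he (key 1),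
      ncard_approxTwoCycles Fact.out n _ _ (by omega) (by omega)]
    congr 2
    -- `e - ⌈e/3⌉ = ⌊e/3⌋ + ⌊(e+1)/3⌋`.
    omega
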